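/- Fix an algebraic closure $\overline{\mathbb Q}$ of $\mathbb Q$; all number fields and their algebraic extensions are taken inside $\overline{\mathbb Q}$. For a number field $K$ and a set $S$ of (archimedean or nonarchimedean) primes of $K$, let $S_f$ be the set of nonarchimedean primes in $S$, let $K_S/K$ be the maximal extension of $K$ unramified outside $S$ (a complex prime above a real prime counts as ramified), and let $G_{K,S}=\mathrm{Gal}(K_S/K)$. For a nonarchimedean prime $\overline{\mathfrak p}$ of $K_S$, let $D_{\overline{\mathfrak p}}\subset G_{K,S}$ be its decomposition group (stabilizer). For a set $T$ of nonarchimedean primes of $K$, let $T(K_S)$ be the set of primes of $K_S$ above the primes in $T$, and put $$\delta_{\sup}(T)=\limsup_{s\to 1+0}\frac{\sum_{\mathfrak p\in T}\mathfrak N(\mathfrak p)^{-s}}{\log\frac1{s-1}},$$ where $\mathfrak N(\mathfrak p)$ is the order of the residue field at $\mathfrak p$. For $i=1,2$, let $K_i$ be a number field, $S_i$ a set of primes of $K_i$, and $T_i\subset S_{i,f}$, and let $\sigma: G_{K_1,S_1}\to G_{K_2,S_2}$ be an isomorphism of profinite groups. The *local correspondence* between $T_1$ and $T_2$ holds for $\sigma$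 if for every $\overline{\mathfrak p}_1\in T_1(K_{1,S_1})$ there is a unique $\sigma_*(\overline{\mathfrak p}_1)\in T_2(K_{2,S_2})$ with $\sigma(D_{\overline{\mathfrak p}_1})=D_{\sigma_*(\overline{\mathfrak p}_1)}$, and the map $\sigma_*:T_1(K_{1,S_1})\to T_2(K_{2,S_2})$ is a bijection; it then induces a bijection $\sigma_{*,K_1}:T_1\to T_2$, $\overline{\mathfrak p}_1|_{K_1}\mapsto\sigma_*(\overline{\mathfrak p}_1)|_{K_2}$. The *good local correspondence* between $T_1$ and $T_2$ holds for $\sigma$ if moreover $\sigma_{*,K_1}$ preserves the residue characteristics and the residual degrees (over $\mathbb Q$) of all primes in $T_1$. **Proposition.** Assume that (a) $K_i/\mathbb Q$ is Galois for $i=1,2$; (b) the good local correspondence between $T_1$ and $T_2$ holds for $\sigma$; (c) $\delta_{\sup}(T_i)>1/2$ for at least one $i\in\{1,2\}$. Then $K_1\simeq K_2$; in fact $K_1=K_2$ as subfields of $\overline{\mathbb Q}$. -/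

import Mathlib

open Filter Topology IsDedekindDomain NumberField
open scoped Pointwise

namespace RestrictedRamification

noncomputable section

/-- The primes of an algebraic extension `F` of `ℚ`: the nonarchimedean ones are the nonzero prime
ideals of the ring of integers, the archimedean ones are the infinite places. -/
abbrev PrimeOf (F : Type*) [Field F] : Type _ := HeightOneSpectrum (𝓞 F) ⊕ InfinitePlace F

/-- `S_f`: the nonarchimedean primes in the set of primes `S`. -/
def finitePart {F : Type*} [Field F] (S : Set (PrimeOf F)) : Set (HeightOneSpectrum (𝓞 F)) :=
  {p | Sum.inl p ∈ S}

section Extension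

variable (K : Type*) [Field K]

/-- `L/K` is unramified outside `S`: every nonarchimedean prime of `L` not above `S` is unramified
over `K`, and every archimedean prime of `L` not above `S` is unramified over `K` (that is, it is
not a complex prime above a real prime). -/
structure IsUnramifiedOutside (S : Set (PrimeOf K)) (L : Type*) [Field L] [Algebra K L]
    [Algebra.IsAlgebraic K L] : Prop where
  finite : ∀ P : HeightOneSpectrum (𝓞 L), Sum.inl (P.under (𝓞 K)) ∉ S →
    Algebra.IsUnramifiedAt (𝓞 K) P.asIdeal
  infinite : ∀ w : InfinitePlace L, Sum.inr (w.comap (algebraMap K L)) ∉ S →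
    w.IsUnramified K

variable (Ω : Type*) [Field Ω] [Algebra K Ω]

/-- `K_S`: the maximal extension of `K` inside the algebraic closure `Ω` unramified outside `S`,
i.e. the compositum of all finite extensions of `K` in `Ω` that are unramified outside `S`. -/
def maxUnramifiedOutside (S : Set (PrimeOf K)) : IntermediateField K Ω :=
  sSup {L : IntermediateField K Ω | ∃ _ : FiniteDimensional K L, IsUnramifiedOutside K S L}

/-- `G_{K,S} = Gal(K_S/K)`, with the Krull topology. -/
abbrev GaloisGroupOutside (S : Set (PrimeOf K)) : Type _ :=
  Gal(maxUnramifiedOutside K Ω S/K)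

/-- `D_P`: the decomposition group of `P` in `Gal(L/K)`, i.e. the stabilizer of `P`. -/
def decompositionGroup {L : Type*} [Field L] [Algebra K L] (P : HeightOneSpectrum (𝓞 L)) :
    Subgroup Gal(L/K) :=
  MulAction.stabilizer Gal(L/K) P.asIdeal

variable {K}

/-- `T(L)`: the set of primes of `L` above the primes in the set `T` of nonarchimedean primes
of `K`. -/
def primesAbove (T : Set (HeightOneSpectrum (𝓞 K))) (L : Type*) [Field L] [Algebra K L]
    [Algebra.IsAlgebraic K L] : Set (HeightOneSpectrum (𝓞 L)) :=
  {P | P.under (𝓞 K) ∈ T}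

/-- The residue characteristic of a nonarchimedean prime. -/
def residueChar (p : HeightOneSpectrum (𝓞 K)) : ℕ := ringChar (𝓞 K ⧸ p.asIdeal)

/-- The residual degree of a nonarchimedean prime over `ℚ`. -/
def residualDegree (p : HeightOneSpectrum (𝓞 K)) : ℕ := p.asIdeal.inertiaDeg ℤ

/-- The upper Dirichlet density
`δ_sup(T) = limsup_{s → 1+0} (∑_{p ∈ T} N(p)^{-s}) / log (1/(s-1))`. -/
def upperDirichletDensity [NumberField K] (T : Set (HeightOneSpectrum (𝓞 K))) : EReal :=
  limsup (fun s : ℝ ↦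
    (((∑' p : T, (Ideal.absNorm p.1.asIdeal : ℝ) ^ (-s)) / Real.log (1 / (s - 1)) : ℝ) : EReal))
    (𝓝[>] 1)

end Extension

section Correspondence

variable {K₁ K₂ Ω : Type*} [Field K₁] [Field K₂] [Field Ω] [Algebra K₁ Ω] [Algebra K₂ Ω]
  [Algebra.IsAlgebraic K₁ Ω] [Algebra.IsAlgebraic K₂ Ω]
  {S₁ : Set (PrimeOf K₁)} {S₂ : Set (PrimeOf K₂)}

/-- `φ : T₁(K_{1,S₁}) → T₂(K_{2,S₂})` is the local correspondence `σ_*` between `T₁` and `T₂`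
for `σ`: it is a bijection, and `φ P` is the unique prime `Q` in `T₂(K_{2,S₂})` with
`σ(D_P) = D_Q`. -/
structure IsLocalCorrespondence
    (σ : GaloisGroupOutside K₁ Ω S₁ ≃ₜ* GaloisGroupOutside K₂ Ω S₂)
    (T₁ : Set (HeightOneSpectrum (𝓞 K₁))) (T₂ : Set (HeightOneSpectrum (𝓞 K₂)))
    (φ : primesAbove T₁ (maxUnramifiedOutside K₁ Ω S₁) →
      primesAbove T₂ (maxUnramifiedOutside K₂ Ω S₂)) : Prop where
  map_iff : ∀ P Q, (decompositionGroup K₁ P.1).map σ.toMulEquiv.toMonoidHom =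
    decompositionGroup K₂ Q.1 ↔ Q = φ P
  bijective : Function.Bijective φ

/-- The local correspondence between `T₁` and `T₂` holds for `σ`. -/
def HasLocalCorrespondence
    (σ : GaloisGroupOutside K₁ Ω S₁ ≃ₜ* GaloisGroupOutside K₂ Ω S₂)
    (T₁ : Set (HeightOneSpectrum (𝓞 K₁))) (T₂ : Set (HeightOneSpectrum (𝓞 K₂))) : Prop :=
  ∃ φ, IsLocalCorrespondence σ T₁ T₂ φ

/-- The good local correspondence between `T₁` and `T₂` holds for `σ`: the local correspondence
`σ_*` exists, and the map `T₁ → T₂`, `P|_{K₁} ↦ σ_*(P)|_{K₂}`, that it induces preserves the residue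
characteristics and the residual degrees. -/
def HasGoodLocalCorrespondence
    (σ : GaloisGroupOutside K₁ Ω S₁ ≃ₜ* GaloisGroupOutside K₂ Ω S₂)
    (T₁ : Set (HeightOneSpectrum (𝓞 K₁))) (T₂ : Set (HeightOneSpectrum (𝓞 K₂))) : Prop :=
  ∃ φ, IsLocalCorrespondence σ T₁ T₂ φ ∧
    ∀ P, residueChar ((φ P).1.under (𝓞 K₂)) = residueChar (P.1.under (𝓞 K₁)) ∧
      residualDegree ((φ P).1.under (𝓞 K₂)) = residualDegree (P.1.under (𝓞 K₁))

end Correspondence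

end

end RestrictedRamification

/-! Let `M` be the compositum of the two fields. It is Galois over ℚ, and by symmetry it suffices to
show that `M` equals the field `K₁` whose set `T₁` has upper density above 1/2.

The good local correspondence enters only through an injection of each `Tᵢ` into the other that
keeps residue characteristic and degree. It therefore keeps norms, so the density bound passes from
one side to the other (`HasGoodLocalCorrespondence.exists_injective`,
`upperDirichletDensity_le_of_injective`).

Discard from `T₁` the primes of residual degree at least 2 and the finitely many above divisors of
the discriminants; their inverse norms have finite sum. A remaining prime and its partner have
degree 1 over the same unramified p, so p splits completely in both Galois fields, hence in `M`. If
some `g ≠ 1` fixed `K₁`, then a prime Q of `M` above such a P and its image gQ would be distinct,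
both of norm N(P). Twice the sum of N(P)^(-s) would then be bounded, up to a constant, by the sum
over all primes of `M`. The pole of the Dedekind zeta function at 1 bounds the latter by
log(1/(s-1)) + O(1), which forces density at most 1/2. Only this upper bound is needed, not
Chebotarev. -/

namespace RestrictedRamification

/-! ### Prime sums bounded by the Dedekind zeta function -/

section Zeta

variable (M : Type*) [Field M] [NumberField M]

theorem tendsto_sum_card_absNorm_div :
    Tendsto (fun n : ℕ ↦
      (∑ k ∈ Finset.Icc 1 n, (Nat.card {I : Ideal (𝓞 M) // Ideal.absNorm I = k} : ℝ)) / n)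
      atTop (𝓝 (dedekindZeta_residue M)) := by
  refine ((Ideal.tendsto_norm_le_div_atTop₀ M).comp tendsto_natCast_atTop_atTop).congr fun n ↦ ?_
  simp only [Function.comp_apply, Nat.cast_le, ← Nat.cast_sum]
  congr
  -- The asymptotic counts nonzero ideals; adding 1 for the zero ideal, the only one of norm 0,
  -- turns it into a count of all ideals.
  rw [← add_left_inj 1, ← Ideal.card_norm_le_eq_card_norm_le_add_one,
    show Finset.Icc 1 n = Finset.Ioc 0 n from Finset.Icc_succ_left_eq_Ioc _ _,
    show 1 = Nat.card {I : Ideal (𝓞 M) // Ideal.absNorm I = 0} by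
      simp [Ideal.absNorm_eq_zero_iff],
    Finset.sum_Ioc_add_eq_sum_Icc (n.zero_le),
    ← Finset.card_preimage_eq_sum_card_image_eq (fun k _ ↦ Ideal.finite_setOfPred_absNorm_eq k)]
  simp [Set.coe_eq_subtype]

theorem lseriesSummable_card_absNorm {s : ℝ} (hs : 1 < s) :
    LSeriesSummable (fun n ↦ (Nat.card {I : Ideal (𝓞 M) // Ideal.absNorm I = n} : ℂ)) s := by
  have hO := Asymptotics.isBigO_of_div_tendsto_nhds ?_ _ (tendsto_sum_card_absNorm_div M)
  · exact LSeriesSummable_of_sum_norm_bigO_and_nonneg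
      (f := fun n ↦ (Nat.card {I : Ideal (𝓞 M) // Ideal.absNorm I = n} : ℝ)) (r := 1)
      (by simpa using hO) (fun _ ↦ by positivity) zero_le_one (by simpa using hs)
  · filter_upwards [eventually_ne_atTop 0] with n hn h
    exact absurd h (mod_cast hn)

theorem hasSum_re_dedekindZeta {s : ℝ} (hs : 1 < s) :
    HasSum (fun n : ℕ ↦
      (Nat.card {I : Ideal (𝓞 M) // Ideal.absNorm I = n} : ℝ) * (n : ℝ) ^ (-s))
      (dedekindZeta M s).re := by
  have h := Complex.hasSum_re (lseriesSummable_card_absNorm M hs).LSeriesHasSum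
  refine h.congr_fun fun n ↦ ?_
  have hs0 : s ≠ 0 := by linarith
  rw [LSeries.term_of_ne_zero' (by exact_mod_cast hs0), div_eq_mul_inv, ← Complex.cpow_neg,
    ← Complex.ofReal_neg, ← Complex.ofReal_natCast n, ← Complex.ofReal_cpow (by positivity),
    ← Complex.ofReal_natCast, ← Complex.ofReal_mul, Complex.ofReal_re]

theorem sum_absNorm_rpow_le_dedekindZeta {s : ℝ} (hs : 1 < s) (A : Finset (Ideal (𝓞 M))) :
    ∑ I ∈ A, (Ideal.absNorm I : ℝ) ^ (-s) ≤ (dedekindZeta M s).re := by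
  classical
  rw [Finset.sum_comp (fun n : ℕ ↦ (n : ℝ) ^ (-s)) (fun I ↦ Ideal.absNorm I)]
  refine le_trans (Finset.sum_le_sum fun n _ ↦ ?_)
    (sum_le_hasSum (A.image fun I ↦ Ideal.absNorm I) (fun n _ ↦ by positivity)
      (hasSum_re_dedekindZeta M hs))
  rw [nsmul_eq_mul]
  gcongr
  have := Ideal.finite_setOfPred_absNorm_eq (S := 𝓞 M) n
  rw [← Set.ncard_coe_finset]
  exact Set.ncard_le_ncard (fun I hI ↦ (Finset.mem_filter.1 hI).2) this

theorem prod_asIdeal_injective {R : Type*} [CommRing R] [IsDedekindDomain R] :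
    Function.Injective fun A : Finset (HeightOneSpectrum R) ↦ ∏ P ∈ A, P.asIdeal := by
  have key (A : Finset (HeightOneSpectrum R)) (P : HeightOneSpectrum R) :
      P ∈ A ↔ P.asIdeal ∣ ∏ Q ∈ A, Q.asIdeal := by
    refine ⟨fun h ↦ Finset.dvd_prod_of_mem _ h, fun h ↦ ?_⟩
    obtain ⟨Q, hQ, hPQ⟩ := (P.prime.dvd_finsetProd_iff _).1 h
    have : P = Q := HeightOneSpectrum.ext
      (Q.isMaximal.eq_of_le P.isPrime.ne_top (Ideal.le_of_dvd hPQ)).symm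
    exact this ▸ hQ
  intro A B h
  ext P
  rw [key A, key B]
  exact iff_of_eq (congrArg _ h)

/-- The product expands into a sum over squarefree ideals, and distinct sets of primes give distinct
ideals. This one-sided bound replaces the Euler product. -/
theorem prod_one_add_le_dedekindZeta {s : ℝ} (hs : 1 < s) (F : Finset (HeightOneSpectrum (𝓞 M))) :
    ∏ P ∈ F, (1 + (Ideal.absNorm P.asIdeal : ℝ) ^ (-s)) ≤ (dedekindZeta M s).re := by
  classical
  rw [Finset.prod_one_add]
  refine le_trans (le_of_eq ?_) (sum_absNorm_rpow_le_dedekindZeta M hs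
    (F.powerset.image fun A ↦ ∏ P ∈ A, P.asIdeal))
  rw [Finset.sum_image (prod_asIdeal_injective.injOn)]
  refine Finset.sum_congr rfl fun A _ ↦ ?_
  rw [map_prod, Nat.cast_prod, ← Real.finsetProd_rpow _ _ (fun _ _ ↦ by positivity)]

theorem one_le_dedekindZeta {s : ℝ} (hs : 1 < s) : 1 ≤ (dedekindZeta M s).re := by
  simpa using prod_one_add_le_dedekindZeta M hs ∅

theorem one_lt_absNorm {M : Type*} [Field M] [NumberField M] (P : HeightOneSpectrum (𝓞 M)) :
    1 < Ideal.absNorm P.asIdeal := by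
  have h0 : Ideal.absNorm P.asIdeal ≠ 0 := by simpa [Ideal.absNorm_eq_zero_iff] using P.ne_bot
  have h1 : Ideal.absNorm P.asIdeal ≠ 1 := by
    simpa [Ideal.absNorm_eq_one_iff] using P.isPrime.ne_top
  lia

/-- Take logarithms of the product bound and use x - x² ≤ log(1 + x). Since s > 1, the squares sum
to at most ζ_M(2), a bound independent of s. -/
theorem sum_absNorm_rpow_le {s : ℝ} (hs : 1 < s) (F : Finset (HeightOneSpectrum (𝓞 M))) :
    ∑ P ∈ F, (Ideal.absNorm P.asIdeal : ℝ) ^ (-s) ≤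
      Real.log (dedekindZeta M s).re + (dedekindZeta M (2 : ℝ)).re := by
  have h1 := Real.log_le_log (Finset.prod_pos fun P _ ↦ by positivity)
    (prod_one_add_le_dedekindZeta M hs F)
  rw [Real.log_prod (fun P _ ↦ by positivity)] at h1
  have h2 : ∑ P ∈ F, (Ideal.absNorm P.asIdeal : ℝ) ^ (-2 : ℝ) ≤ (dedekindZeta M (2 : ℝ)).re := by
    classical
    have := sum_absNorm_rpow_le_dedekindZeta M one_lt_two (F.image HeightOneSpectrum.asIdeal)
    rwa [Finset.sum_image fun P _ Q _ h ↦ HeightOneSpectrum.ext h] at this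
  refine le_trans ?_ (add_le_add h1 h2)
  rw [← Finset.sum_add_distrib]
  refine Finset.sum_le_sum fun P _ ↦ ?_
  have hN : (1 : ℝ) < Ideal.absNorm P.asIdeal := mod_cast one_lt_absNorm P
  set x := (Ideal.absNorm P.asIdeal : ℝ) ^ (-s) with hx
  have hx0 : 0 ≤ x := by positivity
  have hsq : x ^ 2 ≤ (Ideal.absNorm P.asIdeal : ℝ) ^ (-2 : ℝ) := by
    rw [hx, ← Real.rpow_mul_natCast (by positivity)]
    exact Real.rpow_le_rpow_of_exponent_le hN.le (by push_cast; linarith)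
  have hlog := Real.le_log_one_add_of_nonneg hx0
  have : x - x ^ 2 ≤ 2 * x / (x + 2) := by
    rw [le_div_iff₀ (by linarith)]
    nlinarith [mul_nonneg hx0 hx0, mul_nonneg (mul_nonneg hx0 hx0) hx0]
  linarith

theorem summable_absNorm_rpow {s : ℝ} (hs : 1 < s) :
    Summable fun P : HeightOneSpectrum (𝓞 M) ↦ (Ideal.absNorm P.asIdeal : ℝ) ^ (-s) :=
  summable_of_sum_le (fun _ ↦ by positivity) (sum_absNorm_rpow_le M hs)

theorem exists_tsum_absNorm_rpow_le : ∃ C : ℝ, ∀ᶠ s : ℝ in 𝓝[>] 1,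
    ∑' P : HeightOneSpectrum (𝓞 M), (Ideal.absNorm P.asIdeal : ℝ) ^ (-s) ≤
      Real.log (1 / (s - 1)) + C := by
  have hρ := dedekindZeta_residue_pos M
  refine ⟨Real.log (dedekindZeta_residue M + 1) + (dedekindZeta M (2 : ℝ)).re, ?_⟩
  have hlim := (Complex.continuous_re.tendsto _).comp (tendsto_sub_one_mul_dedekindZeta_nhdsGT M)
  -- Near 1, (s-1)ζ_M(s) stays below the residue plus 1; the logarithm of that number enters the
  -- constant.
  have hev := hlim.eventually_lt_const
    (show ((dedekindZeta_residue M : ℂ)).re < dedekindZeta_residue M + 1 by simp)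
  filter_upwards [hev, self_mem_nhdsWithin] with s h hs
  have hs' : 1 < s := hs
  have hs0 : 0 < s - 1 := by linarith
  refine (summable_absNorm_rpow M hs').tsum_le_of_sum_le (fun F ↦ ?_)
  refine (sum_absNorm_rpow_le M hs' F).trans ?_
  have hre : (((s : ℂ) - 1) * dedekindZeta M s).re = (s - 1) * (dedekindZeta M s).re := by
    rw [← Complex.ofReal_one, ← Complex.ofReal_sub, Complex.re_ofReal_mul]
  simp only [Function.comp_apply] at h
  rw [hre] at h
  have h1 := one_le_dedekindZeta M hs'
  have : Real.log (dedekindZeta M s).re ≤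
      Real.log (1 / (s - 1) * (dedekindZeta_residue M + 1)) := by
    apply Real.log_le_log (by linarith)
    rw [one_div, inv_mul_eq_div, le_div_iff₀ hs0]
    linarith
  rw [Real.log_mul (by positivity) (by positivity)] at this
  linarith

end Zeta

/-! ### Residue characteristic, residual degree and norm -/

section Residue

theorem residueChar_mem {K : Type*} [Field K] (P : HeightOneSpectrum (𝓞 K)) :
    (residueChar P : 𝓞 K) ∈ P.asIdeal := by
  rw [← Ideal.Quotient.eq_zero_iff_mem, map_natCast]
  exact CharP.cast_eq_zero _ _

variable {K : Type*} [Field K] [NumberField K]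

theorem residueChar_prime (P : HeightOneSpectrum (𝓞 K)) : (residueChar P).Prime := by
  have := P.isMaximal
  let := Ideal.Quotient.field P.asIdeal
  have : Finite (𝓞 K ⧸ P.asIdeal) := Ideal.finiteQuotientOfFreeOfNeBot _ P.ne_bot
  exact CharP.char_is_prime (𝓞 K ⧸ P.asIdeal) _

theorem liesOver_residueChar (P : HeightOneSpectrum (𝓞 K)) :
    P.asIdeal.LiesOver (Ideal.span {(residueChar P : ℤ)}) :=
  (Ideal.liesOver_span_iff P.isPrime.ne_top
    (Nat.prime_iff_prime_int.1 (residueChar_prime P))).mpr (by simpa using residueChar_mem P)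

theorem eq_residueChar_of_mem (P : HeightOneSpectrum (𝓞 K)) {p : ℕ} (hp : p.Prime)
    (h : (p : 𝓞 K) ∈ P.asIdeal) : p = residueChar P := by
  rw [← Ideal.Quotient.eq_zero_iff_mem, map_natCast, ringChar.spec] at h
  exact ((Nat.prime_dvd_prime_iff_eq (residueChar_prime P) hp).1 h).symm

theorem absNorm_eq_residueChar_pow (P : HeightOneSpectrum (𝓞 K)) :
    Ideal.absNorm P.asIdeal = residueChar P ^ residualDegree P := by
  have := liesOver_residueChar P
  have := P.isPrime
  rw [residualDegree, ← Ideal.natAbs_pow_inertiaDeg (residueChar P : ℤ) P.asIdeal,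
    Int.natAbs_natCast]

theorem residualDegree_pos (P : HeightOneSpectrum (𝓞 K)) : 0 < residualDegree P :=
  have := P.isPrime
  Ideal.inertiaDeg_pos ..

/-- In the identity ∑ e f = [K : ℚ] over the primes above p, every term is at least 1. -/
theorem card_filter_residueChar_le (F : Finset (HeightOneSpectrum (𝓞 K))) (p : ℕ) :
    (F.filter fun P ↦ residueChar P = p).card ≤ Module.finrank ℤ (𝓞 K) := by
  classical
  by_cases hp : p.Prime
  swap
  · rw [Finset.filter_false_of_mem fun P _ (h : residueChar P = p) ↦ hp (h ▸ residueChar_prime P)]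
    simp
  have : (Ideal.span {(p : ℤ)}).IsPrime := by
    rw [Ideal.span_singleton_prime (by simp [hp.ne_zero])]; exact Nat.prime_iff_prime_int.1 hp
  have : Fintype ((Ideal.span {(p : ℤ)}).primesOver (𝓞 K)) :=
    (Algebra.QuasiFinite.finite_primesOver _).fintype
  rw [← Ideal.sum_ramification_inertia_eq_finrank (Ideal.span {(p : ℤ)}) (𝓞 K)]
  refine le_trans ?_ (Finset.card_nsmul_le_sum Finset.univ _ 1 fun Q _ ↦ ?_)
  · rw [smul_eq_mul, mul_one, ← Fintype.card_coe, Finset.card_univ]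
    refine Fintype.card_le_of_injective
      (fun P ↦ ⟨P.1.asIdeal, P.1.isPrime, by
        obtain ⟨P, hP⟩ := P
        obtain rfl := (Finset.mem_filter.1 hP).2
        exact liesOver_residueChar P⟩)
      fun P Q h ↦ Subtype.ext (HeightOneSpectrum.ext (congrArg Subtype.val h))
  · have := Q.2.1
    exact Nat.mul_pos (Ideal.ramificationIdx_pos ..) (Ideal.inertiaDeg_pos ..)

/-- Such a prime has norm at least p², and a bounded number of primes lie above each p, so the sum
is dominated by a multiple of ∑ n⁻². -/
theorem summable_absNorm_inv_of_residualDegree_ne_one :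
    Summable fun P : {P : HeightOneSpectrum (𝓞 K) | residualDegree P ≠ 1} ↦
      (Ideal.absNorm P.1.asIdeal : ℝ)⁻¹ := by
  classical
  refine summable_of_sum_le (fun _ ↦ by positivity)
    (c := Module.finrank ℤ (𝓞 K) * ∑' n : ℕ, ((n : ℝ) ^ 2)⁻¹) fun F ↦ ?_
  have hs : Summable fun n : ℕ ↦ ((n : ℝ) ^ 2)⁻¹ := Real.summable_nat_pow_inv.2 one_lt_two
  calc ∑ P ∈ F, (Ideal.absNorm P.1.asIdeal : ℝ)⁻¹
      ≤ ∑ P ∈ F, ((residueChar P.1 : ℝ) ^ 2)⁻¹ := by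
        refine Finset.sum_le_sum fun P _ ↦ ?_
        have hp := residueChar_prime P.1
        have h2 : 2 ≤ residualDegree P.1 := by
          have := residualDegree_pos P.1
          have : residualDegree P.1 ≠ 1 := P.2
          lia
        rw [absNorm_eq_residueChar_pow]
        push_cast
        have : (1 : ℝ) ≤ residueChar P.1 := mod_cast hp.one_le
        gcongr
    _ = ∑ P ∈ F.map (Function.Embedding.subtype _), ((residueChar P : ℝ) ^ 2)⁻¹ := by
        rw [Finset.sum_map]; rfl
    _ ≤ _ := by
        rw [Finset.sum_comp (fun n : ℕ ↦ ((n : ℝ) ^ 2)⁻¹) (fun P ↦ residueChar P),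
          ← tsum_mul_left]
        refine le_trans (Finset.sum_le_sum fun n _ ↦ ?_)
          ((hs.mul_left _).sum_le_tsum _ fun n _ ↦ by positivity)
        rw [nsmul_eq_mul]
        gcongr
        exact card_filter_residueChar_le _ n

theorem finite_residueChar_dvd {d : ℕ} (hd : d ≠ 0) :
    {P : HeightOneSpectrum (𝓞 K) | residueChar P ∣ d}.Finite := by
  have h0 : Ideal.span {(d : 𝓞 K)} ≠ 0 := by simpa using hd
  refine (Ideal.finite_factors h0).subset fun P hP ↦ ?_
  rw [Set.mem_ofPred_eq, Ideal.dvd_span_singleton]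
  obtain ⟨c, rfl⟩ := hP
  push_cast
  exact P.asIdeal.mul_mem_right _ (residueChar_mem P)

end Residue

/-! ### Upper Dirichlet density -/

section Density

variable {K : Type*} [Field K] [NumberField K]

theorem summable_union_of_nonneg {α : Type*} {f : α → ℝ} (hf : 0 ≤ f) {A B : Set α}
    (hA : Summable fun a : A ↦ f a) (hB : Summable fun b : B ↦ f b) :
    Summable fun c : ↑(A ∪ B) ↦ f c := by
  have hA' := summable_subtype_iff_indicator.1 hA
  have hB' := summable_subtype_iff_indicator.1 hB
  refine summable_subtype_iff_indicator.2 ((hA'.add hB').of_nonneg_of_le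
    (fun a ↦ Set.indicator_nonneg (fun _ _ ↦ hf _) _) fun a ↦ ?_)
  by_cases h1 : a ∈ A <;> by_cases h2 : a ∈ B <;> simp [h1, h2]
  exact hf a

theorem tendsto_log_one_div_sub_one :
    Tendsto (fun s : ℝ ↦ Real.log (1 / (s - 1))) (𝓝[>] 1) atTop := by
  simp only [one_div]
  refine Real.tendsto_log_atTop.comp (tendsto_inv_nhdsGT_zero.comp ?_)
  refine tendsto_nhdsWithin_iff.2 ⟨?_, ?_⟩
  · have : Tendsto (fun s : ℝ ↦ s - 1) (𝓝 1) (𝓝 (1 - 1)) :=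
      (continuous_id.sub continuous_const).tendsto 1
    rw [sub_self] at this
    exact this.mono_left nhdsWithin_le_nhds
  · filter_upwards [self_mem_nhdsWithin] with s hs
    simpa using hs

theorem upperDirichletDensity_le_of_le {T : Set (HeightOneSpectrum (𝓞 K))} {c C : ℝ}
    (h : ∀ᶠ s : ℝ in 𝓝[>] 1, ∑' p : T, (Ideal.absNorm p.1.asIdeal : ℝ) ^ (-s) ≤
      c * Real.log (1 / (s - 1)) + C) :
    upperDirichletDensity T ≤ (c : EReal) := by
  have hlog := tendsto_log_one_div_sub_one
  have hlim : Tendsto (fun s : ℝ ↦ ((c + C / Real.log (1 / (s - 1)) : ℝ) : EReal)) (𝓝[>] 1)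
      (𝓝 ((c + 0 : ℝ) : EReal)) :=
    (continuous_coe_real_ereal.tendsto _).comp (tendsto_const_nhds.add (hlog.const_div_atTop C))
  rw [add_zero] at hlim
  rw [← hlim.limsup_eq]
  refine limsup_le_limsup ?_
  filter_upwards [h, hlog.eventually_gt_atTop 0] with s hs h0
  rw [EReal.coe_le_coe_iff, div_le_iff₀ h0, add_mul, div_mul_cancel₀ _ h0.ne']
  exact hs

theorem upperDirichletDensity_le_of_injective {K' : Type*} [Field K'] [NumberField K']
    {T : Set (HeightOneSpectrum (𝓞 K))} {T' : Set (HeightOneSpectrum (𝓞 K'))}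
    (f : T → T') (hf : Function.Injective f)
    (hN : ∀ P, Ideal.absNorm (f P).1.asIdeal = Ideal.absNorm P.1.asIdeal) :
    upperDirichletDensity T ≤ upperDirichletDensity T' := by
  refine limsup_le_limsup ?_
  filter_upwards [self_mem_nhdsWithin, tendsto_log_one_div_sub_one.eventually_gt_atTop 0]
    with s hs h0
  rw [EReal.coe_le_coe_iff]
  gcongr
  refine Summable.tsum_le_tsum_of_inj f hf (fun _ _ ↦ by positivity) (fun P ↦ ?_)
    ((summable_absNorm_rpow K hs).subtype T) ((summable_absNorm_rpow K' hs).subtype T')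
  rw [hN]

/-- Each prime of `T` outside the negligible set `B` consumes two primes of `M` of the same norm,
while the prime sum of `M` is at most log(1/(s-1)) + O(1). -/
theorem upperDirichletDensity_le_half {M : Type*} [Field M] [NumberField M] [Algebra K M]
    {T B : Set (HeightOneSpectrum (𝓞 K))}
    (hB : Summable fun P : B ↦ (Ideal.absNorm P.1.asIdeal : ℝ)⁻¹)
    (h : ∀ P ∈ T, P ∉ B → ∃ Q : Bool → HeightOneSpectrum (𝓞 M), Function.Injective Q ∧
      ∀ i, (Q i).under (𝓞 K) = P ∧ Ideal.absNorm (Q i).asIdeal = Ideal.absNorm P.asIdeal) :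
    upperDirichletDensity T ≤ ((1 / 2 : ℝ) : EReal) := by
  obtain ⟨C, hC⟩ := exists_tsum_absNorm_rpow_le M
  refine upperDirichletDensity_le_of_le (C := C / 2 +
    ∑' P : B, (Ideal.absNorm P.1.asIdeal : ℝ)⁻¹) ?_
  filter_upwards [hC, self_mem_nhdsWithin] with s hCs hs
  have hs' : (1 : ℝ) < s := hs
  set f : HeightOneSpectrum (𝓞 K) → ℝ := fun P ↦ (Ideal.absNorm P.asIdeal : ℝ) ^ (-s) with hf
  have hsum : Summable f := summable_absNorm_rpow K hs
  choose Q hQi hQ using h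
  have h1 : ∑' P : T, f P ≤ ∑' P : ↑(T \ B), f P + ∑' P : B, f P := by
    rw [tsum_subtype, tsum_subtype, tsum_subtype,
      ← (hsum.indicator _).tsum_add (hsum.indicator _)]
    refine (hsum.indicator _).tsum_le_tsum (fun P ↦ ?_)
      ((hsum.indicator _).add (hsum.indicator _))
    have hP : 0 ≤ f P := by positivity
    by_cases h1 : P ∈ T <;> by_cases h2 : P ∈ B <;> simp [h1, h2, hP]
  have h2 : ∑' P : B, f P ≤ ∑' P : B, (Ideal.absNorm P.1.asIdeal : ℝ)⁻¹ := by
    refine (hsum.subtype B).tsum_le_tsum (fun P ↦ ?_) hB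
    have hN : (1 : ℝ) ≤ Ideal.absNorm P.1.asIdeal := mod_cast (one_lt_absNorm P.1).le
    rw [← Real.rpow_neg_one]
    exact Real.rpow_le_rpow_of_exponent_le hN (by linarith)
  -- The factor `Bool` counts each prime twice, so that a single injection into the primes of `M`
  -- gives the factor 2.
  have hprod : Summable fun x : ↑(T \ B) × Bool ↦ f x.1 := by
    have := (hsum.subtype (T \ B)).mul_of_nonneg
      (Summable.of_finite (f := fun _ : Bool ↦ (1 : ℝ)))
      (fun P ↦ Real.rpow_nonneg (Nat.cast_nonneg _) _)
      (fun _ ↦ zero_le_one)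
    simp only [mul_one] at this
    exact this
  have h3 : ∑' x : ↑(T \ B) × Bool, f x.1 = 2 * ∑' P : ↑(T \ B), f P := by
    rw [hprod.tsum_prod, ← tsum_mul_left]
    simp [two_mul]
  have h4 : ∑' x : ↑(T \ B) × Bool, f x.1 ≤
      ∑' P : HeightOneSpectrum (𝓞 M), (Ideal.absNorm P.asIdeal : ℝ) ^ (-s) := by
    refine hprod.tsum_le_tsum_of_inj (fun x ↦ Q x.1 x.1.2.1 x.1.2.2 x.2) ?_
      (fun _ _ ↦ by positivity) (fun x ↦ ?_) (summable_absNorm_rpow M hs)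
    · rintro ⟨P, i⟩ ⟨P', j⟩ hPP
      have hP : P = P' := by
        refine Subtype.ext ?_
        rw [← (hQ P P.2.1 P.2.2 i).1, ← (hQ P' P'.2.1 P'.2.2 j).1]
        exact congrArg _ hPP
      subst hP
      exact Prod.ext rfl (hQi _ _ _ hPP)
    · rw [(hQ x.1 x.1.2.1 x.1.2.2 x.2).2]
  change ∑' P : T, f P ≤ _
  linarith

end Density

/-! ### Galois action on primes, also in infinite extensions -/

section GaloisAction

variable {K L : Type*} [Field K] [Field L] [Algebra K L]

instance smulCommClass_ringOfIntegers : SMulCommClass Gal(L/K) (𝓞 K) (𝓞 L) where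
  smul_comm g a x := by
    apply RingOfIntegers.ext
    rw [Algebra.smul_def, Algebra.smul_def]
    change g ((algebraMap K L a) * x) = algebraMap K L a * g x
    rw [map_mul, AlgEquiv.commutes]

theorem isInvariant_ringOfIntegers [IsGalois K L] :
    Algebra.IsInvariant (𝓞 K) (𝓞 L) Gal(L/K) where
  isInvariant x hx := by
    have h : (x : L) ∈ (⊥ : IntermediateField K L) :=
      (InfiniteGalois.mem_bot_iff_fixed _).2 fun g ↦ congrArg Subtype.val (hx g)
    obtain ⟨a, ha⟩ := IntermediateField.mem_bot.1 h
    have hint : IsIntegral ℤ a := by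
      have : IsIntegral ℤ (algebraMap K L a) := ha ▸ x.isIntegral_coe
      exact (isIntegral_algHom_iff ((algebraMap K L).toIntAlgHom)
        (algebraMap K L).injective).1 this
    exact ⟨⟨a, hint⟩, RingOfIntegers.ext ha⟩

theorem exists_smul_eq_of_under_eq [IsGalois K L] (P Q : Ideal (𝓞 L)) [P.IsPrime] [Q.IsPrime]
    (h : P.under (𝓞 K) = Q.under (𝓞 K)) : ∃ g : Gal(L/K), Q = g • P := by
  -- The extension may be infinite, so transitivity comes from its profinite form. With the discrete
  -- topology, continuity of the action says that stabilizers of integral elements are open.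
  let : TopologicalSpace (𝓞 L) := ⊥
  have : DiscreteTopology (𝓞 L) := ⟨rfl⟩
  have : ContinuousSMul Gal(L/K) (𝓞 L) := by
    rw [continuousSMul_iff_stabilizer_isOpen]
    intro x
    convert stabilizer_isOpen_of_isIntegral (K := K) (x : L) using 1
    ext g
    exact RingOfIntegers.ext_iff
  have := isInvariant_ringOfIntegers (K := K) (L := L)
  exact Algebra.IsInvariant.exists_smul_of_under_eq_of_profinite P Q h

/-- The image of a prime under an element of the Galois group. -/
def smulPrime (g : Gal(L/K)) (P : HeightOneSpectrum (𝓞 L)) : HeightOneSpectrum (𝓞 L) where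
  asIdeal := g • P.asIdeal
  isPrime := have := P.isPrime; inferInstance
  ne_bot h := P.ne_bot (by rw [← inv_smul_smul g P.asIdeal, h]; exact smul_zero g⁻¹)

theorem smulPrime_under [Algebra.IsAlgebraic K L] (g : Gal(L/K)) (P : HeightOneSpectrum (𝓞 L)) :
    (smulPrime g P).under (𝓞 K) = P.under (𝓞 K) :=
  HeightOneSpectrum.ext (Ideal.under_smul (𝓞 K) P.asIdeal g)

theorem decompositionGroup_smulPrime (g : Gal(L/K)) (P : HeightOneSpectrum (𝓞 L)) :
    decompositionGroup K (smulPrime g P) =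
      (decompositionGroup K P).map (MulAut.conj g).toMonoidHom :=
  MulAction.stabilizer_smul_eq_stabilizer_map_conj g P.asIdeal

end GaloisAction

/-! ### Normality of the maximal extension unramified outside S -/

section Unramified

variable {K : Type*} [Field K] {S : Set (PrimeOf K)}

theorem IsUnramifiedOutside.of_algEquiv {L L' : Type*} [Field L] [Algebra K L]
    [Algebra.IsAlgebraic K L] [Field L'] [Algebra K L'] [Algebra.IsAlgebraic K L']
    (h : IsUnramifiedOutside K S L) (e : L ≃ₐ[K] L') : IsUnramifiedOutside K S L' where
  finite P' hP' := by
    let f : 𝓞 L ≃ₐ[𝓞 K] 𝓞 L' := RingOfIntegers.mapAlgEquiv e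
    let P : HeightOneSpectrum (𝓞 L) :=
      { asIdeal := P'.asIdeal.comap f
        isPrime := have := P'.isPrime; inferInstance
        ne_bot := fun hb ↦ P'.ne_bot (by
          rw [← Ideal.map_comap_of_surjective f f.surjective P'.asIdeal, hb, Ideal.map_bot]) }
    have hunder : P.under (𝓞 K) = P'.under (𝓞 K) := by
      apply HeightOneSpectrum.ext
      ext x
      change f (algebraMap _ _ x) ∈ P'.asIdeal ↔ algebraMap _ _ x ∈ P'.asIdeal
      rw [f.commutes]
    have hP := h.finite P (by rwa [hunder])
    have hmap : P.asIdeal.primeCompl.map f = P'.asIdeal.primeCompl := by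
      ext y
      constructor
      · rintro ⟨x, hx, rfl⟩
        exact hx
      · intro hy
        refine ⟨f.symm y, ?_, f.apply_symm_apply y⟩
        change ¬ f (f.symm y) ∈ P'.asIdeal
        rwa [f.apply_symm_apply]
    exact Algebra.FormallyUnramified.of_equiv
      (IsLocalization.algEquivOfAlgEquiv (Localization.AtPrime P.asIdeal)
        (Localization.AtPrime P'.asIdeal) f hmap)
  infinite w' hw' := by
    have hcomp : (w'.comap (e : L →+* L')).comap (algebraMap K L) =
        w'.comap (algebraMap K L') := by
      rw [← InfinitePlace.comap_comp]
      congr 1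
      exact e.toAlgHom.comp_algebraMap
    have hw := h.infinite (w'.comap (e : L →+* L')) (by rwa [hcomp])
    have := hw.comap_algHom e.symm.toAlgHom
    convert this using 1
    rw [← InfinitePlace.comap_comp]
    have : (e : L →+* L').comp (e.symm.toAlgHom : L' →+* L) = RingHom.id L' := by
      ext x; exact e.apply_symm_apply x
    erw [this, InfinitePlace.comap_id]

/-- A conjugate of a finite extension unramified outside `S` is again one, so every embedding maps
the compositum into itself. -/
theorem normal_maxUnramifiedOutside (Ω : Type*) [Field Ω] [Algebra K Ω] [Normal K Ω] :
    Normal K (maxUnramifiedOutside K Ω S) := by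
  rw [IntermediateField.normal_iff_forall_map_le]
  intro σ
  rw [IntermediateField.map_le_iff_le_comap, maxUnramifiedOutside]
  refine sSup_le fun L hL ↦ ?_
  obtain ⟨hfin, hL⟩ := hL
  rw [← IntermediateField.map_le_iff_le_comap]
  have e := L.equivMap σ
  have : FiniteDimensional K (L.map σ) := e.toLinearEquiv.finiteDimensional
  exact le_sSup ⟨this, hL.of_algEquiv e⟩

end Unramified

/-! ### Consequences of the local correspondence -/

section Correspondence

variable {K₁ K₂ Ω : Type*} [Field K₁] [Field K₂] [Field Ω] [Algebra K₁ Ω] [Algebra K₂ Ω]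
  [Algebra.IsAlgebraic K₁ Ω] [Algebra.IsAlgebraic K₂ Ω]
  {S₁ : Set (PrimeOf K₁)} {S₂ : Set (PrimeOf K₂)}
  {σ : GaloisGroupOutside K₁ Ω S₁ ≃ₜ* GaloisGroupOutside K₂ Ω S₂}
  {T₁ : Set (HeightOneSpectrum (𝓞 K₁))} {T₂ : Set (HeightOneSpectrum (𝓞 K₂))}
  {φ : primesAbove T₁ (maxUnramifiedOutside K₁ Ω S₁) →
      primesAbove T₂ (maxUnramifiedOutside K₂ Ω S₂)}

theorem IsLocalCorrespondence.symm (h : IsLocalCorrespondence σ T₁ T₂ φ) :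
    IsLocalCorrespondence σ.symm T₂ T₁ (Equiv.ofBijective φ h.bijective).symm where
  map_iff Q P := by
    rw [Equiv.eq_symm_apply]
    change _ ↔ φ P = Q
    rw [eq_comm (a := φ P), ← h.map_iff P Q]
    exact Subgroup.map_symm_eq_iff_map_eq _ (e := σ.toMulEquiv)
  bijective := Equiv.bijective _

/-- Equivariance: σ_* carries σ⁻¹(g)P to g σ_*(P), because conjugate primes have conjugate
decomposition groups. Primes with the same restriction are conjugate, so the induced map `T₁ → T₂`
is injective. -/
theorem IsLocalCorrespondence.under_eq [IsGalois K₂ (maxUnramifiedOutside K₂ Ω S₂)]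
    (h : IsLocalCorrespondence σ T₁ T₂ φ)
    {P P' : primesAbove T₁ (maxUnramifiedOutside K₁ Ω S₁)}
    (hP : (φ P).1.under (𝓞 K₂) = (φ P').1.under (𝓞 K₂)) :
    P.1.under (𝓞 K₁) = P'.1.under (𝓞 K₁) := by
  have := (φ P).1.isPrime
  have := (φ P').1.isPrime
  obtain ⟨g, hg⟩ := exists_smul_eq_of_under_eq (K := K₂) (φ P).1.asIdeal (φ P').1.asIdeal
    (congrArg HeightOneSpectrum.asIdeal hP)
  have hg : (φ P').1 = smulPrime g (φ P).1 := HeightOneSpectrum.ext hg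
  let Q : primesAbove T₁ (maxUnramifiedOutside K₁ Ω S₁) := ⟨smulPrime (σ.symm g) P.1, by
    change (smulPrime (σ.symm g) P.1).under (𝓞 K₁) ∈ T₁
    rw [smulPrime_under]
    exact P.2⟩
  have hQ : φ P' = φ Q := by
    rw [← h.map_iff, hg, decompositionGroup_smulPrime, decompositionGroup_smulPrime,
      ← (h.map_iff P (φ P)).2 rfl, Subgroup.map_map, Subgroup.map_map]
    congr 1
    ext1 x
    change σ (σ.symm g * x * (σ.symm g)⁻¹) = g * σ x * g⁻¹
    simp
  rw [h.bijective.1 hQ]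
  exact (smulPrime_under _ _).symm

theorem exists_mem_primesAbove {K L : Type*} [Field K] [Field L] [Algebra K L]
    [Algebra.IsAlgebraic K L] {T : Set (HeightOneSpectrum (𝓞 K))} {p : HeightOneSpectrum (𝓞 K)}
    (hp : p ∈ T) : ∃ P : primesAbove T L, P.1.under (𝓞 K) = p := by
  have := p.isPrime
  obtain ⟨P, hP, hPp⟩ := p.asIdeal.exists_ideal_over_prime_of_isIntegral_of_isDomain (S := 𝓞 L)
    (by simp)
  have hunder : (⟨P, hP, fun h ↦ p.ne_bot (by simpa [h] using hPp.symm)⟩ :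
      HeightOneSpectrum (𝓞 L)).under (𝓞 K) = p := HeightOneSpectrum.ext hPp
  exact ⟨⟨_, by rw [primesAbove, Set.mem_ofPred_eq, hunder]; exact hp⟩, hunder⟩

/-- Compatibility of the good local correspondence with passing to the inverse isomorphism. -/
theorem HasGoodLocalCorrespondence.symm (h : HasGoodLocalCorrespondence σ T₁ T₂) :
    HasGoodLocalCorrespondence σ.symm T₂ T₁ := by
  obtain ⟨φ, hφ, hP⟩ := h
  refine ⟨_, hφ.symm, fun Q ↦ ?_⟩
  have := hP ((Equiv.ofBijective φ hφ.bijective).symm Q)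
  have hQ : φ ((Equiv.ofBijective φ hφ.bijective).symm Q) = Q :=
    (Equiv.ofBijective φ hφ.bijective).apply_symm_apply Q
  rw [hQ] at this
  exact ⟨this.1.symm, this.2.symm⟩

theorem HasGoodLocalCorrespondence.exists_injective
    [IsGalois K₂ (maxUnramifiedOutside K₂ Ω S₂)] (h : HasGoodLocalCorrespondence σ T₁ T₂) :
    ∃ f : T₁ → T₂, Function.Injective f ∧ ∀ p, residueChar (f p).1 = residueChar p.1 ∧
      residualDegree (f p).1 = residualDegree p.1 := by
  obtain ⟨φ, hφ, hP⟩ := h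
  choose P hPp using fun p : T₁ ↦
    exists_mem_primesAbove (L := maxUnramifiedOutside K₁ Ω S₁) p.2
  refine ⟨fun p ↦ ⟨(φ (P p)).1.under (𝓞 K₂), (φ (P p)).2⟩, fun p q hpq ↦ ?_, fun p ↦ ?_⟩
  · have := hφ.under_eq (congrArg Subtype.val hpq)
    rw [hPp, hPp] at this
    exact Subtype.ext this
  · simpa only [hPp] using hP (P p)

end Correspondence

/-! ### Complete splitting in Galois number fields -/

section Split

theorem isUnramifiedAt_of_not_dvd_discr {K : Type*} [Field K] [NumberField K]
    (P : HeightOneSpectrum (𝓞 K))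
    (h : ¬ residueChar P ∣ (discr K).natAbs) :
    Algebra.IsUnramifiedAt ℤ P.asIdeal := by
  have hp := Nat.prime_iff_prime_int.1 (residueChar_prime P)
  refine (not_dvd_discr_iff_forall_mem K (𝓞 K) hp).1 ?_ P.asIdeal P.isPrime
    (by simpa using residueChar_mem P)
  rwa [← Int.natCast_dvd] at h

variable {K : Type*} [Field K] [NumberField K] [IsGalois ℚ K]

/-- The stabilizer has order e f, and in a Galois extension e and f are the same for all primes
above p. Hence the information on `P` passes to every `Q` above the same p. -/
theorem stabilizer_eq_bot_of_residualDegree_eq_one {P Q : HeightOneSpectrum (𝓞 K)}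
    (hPQ : residueChar P = residueChar Q) (hP : residualDegree P = 1)
    (h : ¬ residueChar P ∣ (discr K).natAbs) :
    MulAction.stabilizer Gal(K/ℚ) Q.asIdeal = ⊥ := by
  have := isUnramifiedAt_of_not_dvd_discr P h
  have := P.isPrime
  have := Q.isPrime
  have hp := Nat.prime_iff_prime_int.1 (residueChar_prime P)
  have hpP := liesOver_residueChar P
  have : Q.asIdeal.LiesOver (Ideal.span {(residueChar P : ℤ)}) := hPQ ▸ liesOver_residueChar Q
  have : (Ideal.span {(residueChar P : ℤ)}).IsPrime := by
    rwa [Ideal.span_singleton_prime hp.ne_zero]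
  rw [← Subgroup.card_eq_one,
    Ideal.card_stabilizer_eq (Ideal.span {(residueChar P : ℤ)}) Q.asIdeal,
    Ideal.ramificationIdxIn_eq_ramificationIdx _ P.asIdeal Gal(K/ℚ),
    Ideal.inertiaDegIn_eq_inertiaDeg _ P.asIdeal Gal(K/ℚ),
    Ideal.ramificationIdx_eq_one_of_isUnramifiedAt, one_mul]
  exact hP

/-- The residual degree divides the order of the stabilizer. -/
theorem residualDegree_eq_one_of_stabilizer_eq_bot {Q : HeightOneSpectrum (𝓞 K)}
    (h : MulAction.stabilizer Gal(K/ℚ) Q.asIdeal = ⊥) : residualDegree Q = 1 := by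
  have := Q.isPrime
  have hp := Nat.prime_iff_prime_int.1 (residueChar_prime Q)
  have := liesOver_residueChar Q
  have : (Ideal.span {(residueChar Q : ℤ)}).IsPrime := by
    rwa [Ideal.span_singleton_prime hp.ne_zero]
  rw [← Subgroup.card_eq_one,
    Ideal.card_stabilizer_eq_card_inertia_mul_finrank (Ideal.span {(residueChar Q : ℤ)})] at h
  exact (mul_eq_one.1 h).2

theorem residueChar_under {M : Type*} [Field M] [NumberField M] {K : Type*} [Field K]
    [NumberField K] [Algebra K M] (Q : HeightOneSpectrum (𝓞 M)) :
    residueChar (Q.under (𝓞 K)) = residueChar Q := by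
  refine eq_residueChar_of_mem Q (residueChar_prime _) ?_
  have : algebraMap (𝓞 K) (𝓞 M) (residueChar (Q.under (𝓞 K)) : 𝓞 K) ∈ Q.asIdeal :=
    residueChar_mem (Q.under (𝓞 K))
  rwa [map_natCast] at this

/-- The restriction of `g` to `K` stabilizes the prime below `Q`, hence is trivial. -/
theorem fixes_of_smul_eq {M : Type*} [Field M] [NumberField M] [IsGalois ℚ M] [Algebra K M]
    {Q : HeightOneSpectrum (𝓞 M)} {g : Gal(M/ℚ)} (hg : g • Q.asIdeal = Q.asIdeal)
    (h : MulAction.stabilizer Gal(K/ℚ) (Q.under (𝓞 K)).asIdeal = ⊥) (x : K) :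
    g (algebraMap K M x) = algebraMap K M x := by
  let r := IsGaloisGroup.restrictHom Gal(M/ℚ) Gal(K/ℚ) ℚ K M
  have hr (y : K) : algebraMap K M (r g y) = g (algebraMap K M y) :=
    IsGaloisGroup.algebraMap_restrictHom_smul Gal(M/ℚ) Gal(K/ℚ) ℚ K M g y
  have hmem : r g ∈ MulAction.stabilizer Gal(K/ℚ) (Q.under (𝓞 K)).asIdeal := by
    -- Both ideals are maximal, so one inclusion suffices.
    refine ((smulPrime (r g) (Q.under (𝓞 K))).isMaximal.eq_of_le (Q.under (𝓞 K)).isPrime.ne_top ?_)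
    change r g • (Q.under (𝓞 K)).asIdeal ≤ _
    rw [Ideal.pointwise_smul_def, Ideal.map_le_iff_le_comap]
    intro y hy
    have hy' : g • algebraMap (𝓞 K) (𝓞 M) y ∈ g • Q.asIdeal :=
      Ideal.smul_mem_pointwise_smul _ _ _ hy
    rw [hg] at hy'
    have : algebraMap (𝓞 K) (𝓞 M) (r g • y) = g • algebraMap (𝓞 K) (𝓞 M) y :=
      RingOfIntegers.ext (hr y)
    rwa [← this] at hy'
  rw [h, Subgroup.mem_bot] at hmem
  rw [← hr, hmem, AlgEquiv.one_apply]

end Split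

theorem summable_absNorm_inv_of_residualDegree_ne_one_or_dvd {K : Type*} [Field K] [NumberField K]
    {d : ℕ} (hd : d ≠ 0) :
    Summable fun P : ↑({P : HeightOneSpectrum (𝓞 K) | residualDegree P ≠ 1} ∪
      {P | residueChar P ∣ d}) ↦ (Ideal.absNorm P.1.asIdeal : ℝ)⁻¹ := by
  let f : HeightOneSpectrum (𝓞 K) → ℝ := fun P ↦ (Ideal.absNorm P.asIdeal : ℝ)⁻¹
  have hf : 0 ≤ f := fun P ↦ inv_nonneg.2 (Nat.cast_nonneg _)
  have hA : Summable fun P : {P : HeightOneSpectrum (𝓞 K) | residualDegree P ≠ 1} ↦ f P :=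
    summable_absNorm_inv_of_residualDegree_ne_one (K := K)
  have hB : Summable fun P : {P : HeightOneSpectrum (𝓞 K) | residueChar P ∣ d} ↦ f P :=
    have := (finite_residueChar_dvd (K := K) hd).to_subtype
    Summable.of_finite
  exact summable_union_of_nonneg hf hA hB

/-! ### The density argument in the compositum -/

section Main

variable {K₁ K₂ M : Type*} [Field K₁] [NumberField K₁] [Field K₂] [NumberField K₂]
  [Field M] [NumberField M] [IsGalois ℚ K₁] [IsGalois ℚ K₂] [IsGalois ℚ M]
  [Algebra K₁ M] [Algebra K₂ M]

/-- `hgen` expresses that `M` is generated by the two fields. An element stabilizing `Q` restricts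
trivially to each of them, so it is the identity. -/
theorem stabilizer_eq_bot_of_residualDegree_eq_one_of_compositum
    (hgen : ∀ g : Gal(M/ℚ), (∀ x : K₁, g (algebraMap K₁ M x) = algebraMap K₁ M x) →
      (∀ x : K₂, g (algebraMap K₂ M x) = algebraMap K₂ M x) → g = 1)
    {P₁ : HeightOneSpectrum (𝓞 K₁)} {P₂ : HeightOneSpectrum (𝓞 K₂)}
    (h₁ : residualDegree P₁ = 1) (h₂ : residualDegree P₂ = 1)
    (h₁₂ : residueChar P₂ = residueChar P₁)
    (hd₁ : ¬ residueChar P₁ ∣ (discr K₁).natAbs) (hd₂ : ¬ residueChar P₂ ∣ (discr K₂).natAbs)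
    {Q : HeightOneSpectrum (𝓞 M)} (hQ : Q.under (𝓞 K₁) = P₁) :
    MulAction.stabilizer Gal(M/ℚ) Q.asIdeal = ⊥ := by
  have hQP : residueChar Q = residueChar P₁ := by rw [← residueChar_under (K := K₁), hQ]
  refine (Subgroup.eq_bot_iff_forall _).2 fun g hg ↦ hgen g
    (fixes_of_smul_eq hg (stabilizer_eq_bot_of_residualDegree_eq_one (P := P₁) ?_ h₁ hd₁))
    (fixes_of_smul_eq hg (stabilizer_eq_bot_of_residualDegree_eq_one (P := P₂) ?_ h₂ hd₂))
  · rw [residueChar_under, hQP]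
  · rw [residueChar_under, hQP, h₁₂]

theorem forall_eq_one_of_half_lt_upperDirichletDensity
    (hgen : ∀ g : Gal(M/ℚ), (∀ x : K₁, g (algebraMap K₁ M x) = algebraMap K₁ M x) →
      (∀ x : K₂, g (algebraMap K₂ M x) = algebraMap K₂ M x) → g = 1)
    {T : Set (HeightOneSpectrum (𝓞 K₁))}
    (hT : ((1 / 2 : ℝ) : EReal) < upperDirichletDensity T)
    (h : ∀ p ∈ T, ∃ q : HeightOneSpectrum (𝓞 K₂), residueChar q = residueChar p ∧
      residualDegree q = residualDegree p)
    (g : Gal(M/K₁)) : g = 1 := by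
  by_contra hg
  refine hT.not_ge ?_
  have hd : (discr K₁).natAbs * (discr K₂).natAbs ≠ 0 :=
    mul_ne_zero (Int.natAbs_ne_zero.2 (discr_ne_zero K₁)) (Int.natAbs_ne_zero.2 (discr_ne_zero K₂))
  refine upperDirichletDensity_le_half (M := M)
    (summable_absNorm_inv_of_residualDegree_ne_one_or_dvd hd) fun P hPT hPB ↦ ?_
  simp only [Set.mem_union, Set.mem_ofPred_eq, not_or, not_not] at hPB
  obtain ⟨hP1, hPd⟩ := hPB
  obtain ⟨P₂, hP₂, hP₂1⟩ := h P hPT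
  have hstab {R : HeightOneSpectrum (𝓞 M)} (hR : R.under (𝓞 K₁) = P) :
      MulAction.stabilizer Gal(M/ℚ) R.asIdeal = ⊥ :=
    stabilizer_eq_bot_of_residualDegree_eq_one_of_compositum hgen hP1 (hP₂1.trans hP1) hP₂
      (fun hdvd ↦ hPd (hdvd.mul_right _)) (fun hdvd ↦ hPd ((hP₂ ▸ hdvd).mul_left _)) hR
  have hnorm {R : HeightOneSpectrum (𝓞 M)} (hR : R.under (𝓞 K₁) = P) :
      Ideal.absNorm R.asIdeal = Ideal.absNorm P.asIdeal := by
    rw [absNorm_eq_residueChar_pow, absNorm_eq_residueChar_pow,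
      residualDegree_eq_one_of_stabilizer_eq_bot (hstab hR), hP1,
      ← residueChar_under (K := K₁), hR]
  obtain ⟨Q, hQ⟩ := exists_mem_primesAbove (L := M) (T := {P}) (Set.mem_singleton P)
  have hunder : (smulPrime g Q.1).under (𝓞 K₁) = P := by rw [smulPrime_under, hQ]
  -- Freeness: a nontrivial `g` cannot stabilize a prime whose stabilizer over ℚ is trivial.
  have hne : smulPrime g Q.1 ≠ Q.1 := fun heq ↦ by
    have hmem : g.restrictScalars ℚ ∈ MulAction.stabilizer Gal(M/ℚ) Q.1.asIdeal :=
      congrArg HeightOneSpectrum.asIdeal heq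
    rw [hstab hQ, Subgroup.mem_bot] at hmem
    exact hg (AlgEquiv.ext fun x ↦ DFunLike.congr_fun hmem x)
  refine ⟨Bool.rec (smulPrime g Q.1) Q.1, ?_, ?_⟩
  · rintro (_ | _) (_ | _) hb
    exacts [rfl, absurd hb hne, absurd hb.symm hne, rfl]
  · rintro (_ | _)
    exacts [⟨hunder, hnorm hunder⟩, ⟨hQ, hnorm hQ⟩]

theorem surjective_algebraMap_of_half_lt_upperDirichletDensity
    (hgen : ∀ g : Gal(M/ℚ), (∀ x : K₁, g (algebraMap K₁ M x) = algebraMap K₁ M x) →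
      (∀ x : K₂, g (algebraMap K₂ M x) = algebraMap K₂ M x) → g = 1)
    {T : Set (HeightOneSpectrum (𝓞 K₁))}
    (hT : ((1 / 2 : ℝ) : EReal) < upperDirichletDensity T)
    (h : ∀ p ∈ T, ∃ q : HeightOneSpectrum (𝓞 K₂), residueChar q = residueChar p ∧
      residualDegree q = residualDegree p) :
    Function.Surjective (algebraMap K₁ M) := by
  have : IsGalois K₁ M := IsGalois.tower_top_of_isGalois ℚ K₁ M
  intro x
  have hx : x ∈ (⊥ : IntermediateField K₁ M) :=
    (IsGalois.mem_bot_iff_fixed x).2 fun g ↦ by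
      rw [forall_eq_one_of_half_lt_upperDirichletDensity hgen hT h g, AlgEquiv.one_apply]
  exact IntermediateField.mem_bot.1 hx

end Main

/-! ### Descent to subfields of the algebraic closure -/

section Subfields

/-- An intermediate field carries two ℚ-algebra structures, one inherited from `Ω` and one from
characteristic zero; they are equal but not interchangeable for instance search. -/
theorem isGalois_rat_congr {F : Type*} [Field F] (a b : Algebra ℚ F)
    (h : @IsGalois ℚ _ F _ a) : @IsGalois ℚ _ F _ b := by
  obtain rfl := Subsingleton.elim a b
  exact h

theorem numberField_iff_finiteDimensional {F : Type*} [Field F] [CharZero F] (a : Algebra ℚ F) :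
    NumberField F ↔ FiniteDimensional ℚ F := by
  obtain rfl := Subsingleton.elim a DivisionRing.toRatAlgebra
  exact ⟨fun h ↦ h.to_finiteDimensional, fun h ↦ { to_finiteDimensional := h }⟩

variable {Ω : Type*} [Field Ω] [Algebra ℚ Ω]

/-- The equality locus of `g` and the identity is a subfield containing both generating fields.
Taking `g` as a mere ring homomorphism avoids choosing a ℚ-algebra structure. -/
theorem apply_eq_self_of_fixes_sup {K₁ K₂ : IntermediateField ℚ Ω}
    (g : ↥(K₁ ⊔ K₂) →+* ↥(K₁ ⊔ K₂))
    (h₁ : ∀ x (hx : x ∈ K₁), g ⟨x, (le_sup_left : K₁ ≤ K₁ ⊔ K₂) hx⟩ =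
      ⟨x, le_sup_left (a := K₁) hx⟩)
    (h₂ : ∀ x (hx : x ∈ K₂), g ⟨x, (le_sup_right : K₂ ≤ K₁ ⊔ K₂) hx⟩ =
      ⟨x, le_sup_right (b := K₂) hx⟩)
    (x : ↥(K₁ ⊔ K₂)) : g x = x := by
  let E : Subfield ↥(K₁ ⊔ K₂) := g.eqLocusField (RingHom.id _)
  have key : ∀ y (hy : y ∈ IntermediateField.adjoin ℚ ((K₁ : Set Ω) ∪ K₂)),
      ∃ h : y ∈ K₁ ⊔ K₂, (⟨y, h⟩ : ↥(K₁ ⊔ K₂)) ∈ E := by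
    intro y hy
    induction hy using IntermediateField.adjoin_induction with
    | mem y hy =>
      rcases hy with hy | hy
      · exact ⟨_, h₁ y hy⟩
      · exact ⟨_, h₂ y hy⟩
    | algebraMap q => exact ⟨_, h₁ _ (K₁.algebraMap_mem q)⟩
    | add y z _ _ hy hz => exact ⟨_, E.add_mem hy.2 hz.2⟩
    | inv y _ hy => exact ⟨_, E.inv_mem hy.2⟩
    | mul y z _ _ hy hz => exact ⟨_, E.mul_mem hy.2 hz.2⟩
  exact (key x x.2).2

theorem le_of_half_lt_upperDirichletDensity (K₁ K₂ : IntermediateField ℚ Ω)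
    [NumberField K₁] [NumberField K₂] (h₁ : IsGalois ℚ K₁) (h₂ : IsGalois ℚ K₂)
    {T : Set (HeightOneSpectrum (𝓞 K₁))}
    (hT : ((1 / 2 : ℝ) : EReal) < upperDirichletDensity T)
    (h : ∀ p ∈ T, ∃ q : HeightOneSpectrum (𝓞 K₂), residueChar q = residueChar p ∧
      residualDegree q = residualDegree p) : K₂ ≤ K₁ := by
  let M := K₁ ⊔ K₂
  let : Algebra K₁ M := (IntermediateField.inclusion (le_sup_left : K₁ ≤ M)).toAlgebra
  let : Algebra K₂ M := (IntermediateField.inclusion (le_sup_right : K₂ ≤ M)).toAlgebra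
  have hf₁ : FiniteDimensional ℚ K₁ :=
    (numberField_iff_finiteDimensional K₁.algebra').1 inferInstance
  have hf₂ : FiniteDimensional ℚ K₂ :=
    (numberField_iff_finiteDimensional K₂.algebra').1 inferInstance
  have : CharZero M := charZero_of_injective_algebraMap (algebraMap ℚ M).injective
  have : NumberField M := (numberField_iff_finiteDimensional M.algebra').2
    (IntermediateField.finiteDimensional_sup K₁ K₂)
  have hn : @Normal ℚ M _ _ M.algebra' :=
    @IntermediateField.normal_sup ℚ Ω _ _ _ K₁ K₂
      (isGalois_rat_congr _ K₁.algebra' h₁).to_normal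
      (isGalois_rat_congr _ K₂.algebra' h₂).to_normal
  have hM : IsGalois ℚ M := isGalois_rat_congr M.algebra' _
    (@IsGalois.mk ℚ _ M _ M.algebra' inferInstance hn)
  have hsurj : Function.Surjective (algebraMap K₁ M) := by
    refine surjective_algebraMap_of_half_lt_upperDirichletDensity (K₂ := K₂) (fun g hg₁ hg₂ ↦ ?_)
      hT h
    exact AlgEquiv.ext fun x ↦ apply_eq_self_of_fixes_sup (g : M →+* M)
      (fun y hy ↦ hg₁ ⟨y, hy⟩) (fun y hy ↦ hg₂ ⟨y, hy⟩) x
  intro x hx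
  obtain ⟨y, hy⟩ := hsurj ⟨x, (le_sup_right : K₂ ≤ M) hx⟩
  have : (y : Ω) = x := congrArg Subtype.val hy
  exact this ▸ y.2

end Subfields
end RestrictedRamification

open RestrictedRamification in
theorem proposition3p3 {Ω : Type*} [Field Ω] [Algebra ℚ Ω] [IsAlgClosure ℚ Ω]
    (K₁ K₂ : IntermediateField ℚ Ω) [NumberField K₁] [NumberField K₂]
    (S₁ : Set (PrimeOf K₁)) (S₂ : Set (PrimeOf K₂))
    (T₁ : Set (HeightOneSpectrum (𝓞 K₁))) (T₂ : Set (HeightOneSpectrum (𝓞 K₂)))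
    (hT₁ : T₁ ⊆ finitePart S₁) (hT₂ : T₂ ⊆ finitePart S₂)
    (σ : GaloisGroupOutside K₁ Ω S₁ ≃ₜ* GaloisGroupOutside K₂ Ω S₂)
    (hGal₁ : IsGalois ℚ K₁) (hGal₂ : IsGalois ℚ K₂)
    (hσ : HasGoodLocalCorrespondence σ T₁ T₂)
    (hδ : ((1 / 2 : ℝ) : EReal) < upperDirichletDensity T₁ ∨
      ((1 / 2 : ℝ) : EReal) < upperDirichletDensity T₂) :
    Nonempty (K₁ ≃+* K₂) ∧ K₁ = K₂ := by
  have : IsAlgClosed Ω := IsAlgClosure.isAlgClosed ℚ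
  have (K : IntermediateField ℚ Ω) [NumberField K] (S : Set (PrimeOf K)) :
      IsGalois K (maxUnramifiedOutside K Ω S) := by
    have : Normal K Ω := ⟨fun x ↦ IsAlgClosed.splits _⟩
    have := normal_maxUnramifiedOutside (S := S) Ω
    constructor
  obtain ⟨f, hf, hfT⟩ := hσ.exists_injective
  obtain ⟨f', hf', hfT'⟩ := hσ.symm.exists_injective
  have hnorm {K K' : IntermediateField ℚ Ω} [NumberField K] [NumberField K']
      {p : HeightOneSpectrum (𝓞 K)} {q : HeightOneSpectrum (𝓞 K')}
      (h : residueChar q = residueChar p ∧ residualDegree q = residualDegree p) :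
      Ideal.absNorm q.asIdeal = Ideal.absNorm p.asIdeal := by
    rw [absNorm_eq_residueChar_pow, absNorm_eq_residueChar_pow, h.1, h.2]
  have hδ₁₂ := upperDirichletDensity_le_of_injective f hf fun p ↦ hnorm (hfT p)
  have hδ₂₁ := upperDirichletDensity_le_of_injective f' hf' fun p ↦ hnorm (hfT' p)
  -- The two densities bound each other, so the hypothesis on one side yields both, and each gives
  -- one inclusion.
  have hδ₁ := hδ.elim id fun h ↦ h.trans_le hδ₂₁
  have hδ₂ := hδ₁.trans_le hδ₁₂
  have heq : K₁ = K₂ := le_antisymm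
    (le_of_half_lt_upperDirichletDensity K₂ K₁ hGal₂ hGal₁ hδ₂ fun p hp ↦ ⟨_, hfT' ⟨p, hp⟩⟩)
    (le_of_half_lt_upperDirichletDensity K₁ K₂ hGal₁ hGal₂ hδ₁ fun p hp ↦ ⟨_, hfT ⟨p, hp⟩⟩)
  subst heq
  exact ⟨⟨RingEquiv.refl _⟩, rfl⟩
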